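/- Let $(W,\mathcal S)$ be a finite Coxeter system, let $\mathsf c$ be a Coxeter word (a word in which every element of $\mathcal S$ occurs exactly once), let $c\in W$ be the product of its letters, and let $m\ge 0$ be an integer. Let $w_0$ be the maximal element of the weak order of $W$, and let $s_1\cdots s_N$ be its $\mathsf c$-sorting word, that is, the leftmost (lexicographically first) subword of $\mathsf c^\infty=\mathsf c\mathsf c\mathsf c\cdots$ that is a reduced word of $w_0$. Put $t_i=s_1\cdots s_{i-1}s_is_{i-1}\cdots s_1$ and let $R(\mathsf c)=t_1t_2\cdots t_N$, which lists all reflections of $W$. The letters of $R(\mathsf c)^{m+1}$ are called colored reflections: $t^{(i)}$ denotes the reflection $t$ in the $i$-th copy of $R(\mathsf c)$, where $0\le i\le m$ is its color. They are totally ordered by $\le_{\mathsf c}$: first by color, then by position in $R(\mathsf c)$. An $m$-factorization of $\mathsf c$ is a subword of $R(\mathsf c)^{m+1}$, regarded as a set of colored reflections, whose product in the order $\le_{\mathsf c}$ is $c$ and whose number of letters is the absolute length of $c$ (the least number of reflections with product $c$). If an $m$-factorization $\mathsf w$ contains $r^{(i)}$ with $i<m$, the increasing rotation of $\mathsf w$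 at the rotated reflection $r^{(i)}$ is obtained by replacing $r^{(i)}$ by $r^{(i+1)}$ and each letter $t^{(j)}$ of $\mathsf w$ strictly between $r^{(i)}$ and $r^{(i+1)}$ by the unique colored reflection strictly between $r^{(i)}$ and $r^{(i+1)}$ whose underlying reflection is $rtr$; all other letters are kept. The $m$-Cambrian lattice (noncrossing version) is the set of $m$-factorizations of $\mathsf c$ ordered by the reflexive and transitive closure of increasing rotations; its covering relations are exactly the increasing rotations. A saturated chain $\mathsf w_0\lessdot\mathsf w_1\lessdot\cdots\lessdot\mathsf w_k$ ($k\ge 0$) in this poset is called $\mathsf c$-increasing if its rotated reflections $r_1,\dots,r_k$, where $\mathsf w_j$ is the increasing rotation of $\mathsf w_{j-1}$ at $r_j$, satisfy $r_1\le_{\mathsf c} r_2\le_{\mathsf c}\cdots\le_{\mathsf c} r_k$. Then for any two $m$-factorizations $\mathsf w,\mathsf w'$ of $\mathsf c$ there is at most one $\mathsf c$-increasing saturated chain from $\mathsf w$ to $\mathsf w'$. -/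

import Mathlib

namespace MCambrian

section Coxeter

variable {B W : Type*} [Group W] {M : CoxeterMatrix B}

/-- The right weak order on a Coxeter group: `u ≤ w` when `w = u v` with `ℓ(w) = ℓ(u) + ℓ(v)`. -/
def WeakLE (cs : CoxeterSystem M W) (u w : W) : Prop :=
  ∃ v : W, w = u * v ∧ cs.length w = cs.length u + cs.length v

theorem exists_weak_maximal (cs : CoxeterSystem M W) [Finite W] :
    ∃ w : W, ∀ u : W, WeakLE cs w u → u = w := by
  obtain ⟨w, hw⟩ := Finite.exists_max cs.length
  refine ⟨w, ?_⟩
  rintro u ⟨v, rfl, h⟩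
  have h1 := hw (w * v)
  have h2 : cs.length v = 0 := by omega
  rw [cs.length_eq_zero_iff] at h2
  simp [h2]

/-- The maximal element `w₀` of the weak order of a finite Coxeter group. -/
noncomputable def longest (cs : CoxeterSystem M W) [Finite W] : W :=
  Classical.choose (exists_weak_maximal cs)

/-- The absolute length: the least number of reflections whose product is `w`. -/
noncomputable def absLength (cs : CoxeterSystem M W) (w : W) : ℕ :=
  sInf {k : ℕ | ∃ l : List W, (∀ t ∈ l, cs.IsReflection t) ∧ l.length = k ∧ l.prod = w}

theorem absLength_le {cs : CoxeterSystem M W} {w : W} {l : List W} (hl : ∀ t ∈ l, cs.IsReflection t)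
    (h : l.prod = w) : absLength cs w ≤ l.length :=
  Nat.sInf_le ⟨l, hl, rfl, h⟩

/-- A Coxeter word: every simple generator occurs exactly once. -/
structure CoxeterWord (B : Type*) where
  letters : List B
  nodup : letters.Nodup
  complete : ∀ i : B, i ∈ letters

/-- Positions of the infinite word `c^∞`: a pair `(k, i)` is the `i`-th letter of the `k`-th
copy of `c`; positions are ordered lexicographically. -/
abbrev CoxeterWord.Pos (c : CoxeterWord B) : Type := ℕ ×ₗ Fin c.letters.length

/-- The letter of `c^∞` at a given position. -/
def CoxeterWord.letter (c : CoxeterWord B) (x : c.Pos) : B := c.letters.get (ofLex x).2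

/-- The increasing sequence of positions `p` selects a subword of `c^∞` that is a reduced word
of `w` (a word for `w` of length `ℓ(w)`). -/
def SelectsReducedWord (cs : CoxeterSystem M W) (c : CoxeterWord B) (w : W)
    (p : Lex (Fin (cs.length w) → c.Pos)) : Prop :=
  StrictMono (ofLex p) ∧ cs.wordProd (List.ofFn fun j => c.letter (ofLex p j)) = w

theorem exists_selectsReducedWord (cs : CoxeterSystem M W) (c : CoxeterWord B) (w : W) :
    {p | SelectsReducedWord cs c w p}.Nonempty := by
  obtain ⟨u, hu, hw⟩ := cs.exists_isReduced w
  have hlen : u.length = cs.length w := by rw [hw]; exact hu.eq.symm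
  have hpos : ∀ b : B, ∃ i : Fin c.letters.length, c.letters.get i = b := fun b =>
    List.mem_iff_get.1 (c.complete b)
  choose f hf using hpos
  refine ⟨toLex fun j => toLex (j.1, f (u.get (j.cast hlen.symm))), ?_, ?_⟩
  · intro a b hab
    exact Prod.Lex.toLex_lt_toLex.2 (Or.inl hab)
  · have : (List.ofFn fun j : Fin (cs.length w) => u.get (j.cast hlen.symm)) = u := by
      apply List.ext_get
      · simp [hlen]
      · intro n h1 h2
        simp
    simp only [CoxeterWord.letter, ofLex_toLex, hf]
    rw [this]
    exact hw.symm

/-- The positions in `c^∞` of the `c`-sorting word of `w`: the lexicographically first (leftmost)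
sequence of positions that selects a reduced word of `w`. -/
noncomputable def sortingPositions (cs : CoxeterSystem M W) (c : CoxeterWord B) (w : W) :
    Lex (Fin (cs.length w) → c.Pos) :=
  WellFounded.min (wellFounded_lt (α := Lex (Fin (cs.length w) → c.Pos)))
    {p | SelectsReducedWord cs c w p} (exists_selectsReducedWord cs c w)

/-- The `c`-sorting word of `w`. -/
noncomputable def sortingWord (cs : CoxeterSystem M W) (c : CoxeterWord B) (w : W) : List B :=
  List.ofFn fun j => c.letter (ofLex (sortingPositions cs c w) j)

/-- The word `R(c) = t₁ ⋯ t_r` of reflections: if `s₁ ⋯ s_r` is the `c`-sorting word of `w₀`, then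
`tᵢ = s₁ ⋯ sᵢ₋₁ sᵢ sᵢ₋₁ ⋯ s₁`. It lists the reflections in the reflection order `≤_c`. -/
noncomputable def reflWord (cs : CoxeterSystem M W) [Finite W] (c : CoxeterWord B) : List W :=
  cs.leftInvSeq (sortingWord cs c (longest cs))

/-- Colored reflections, that is, the letters of `R(c)^{m+1}`: the pair `(i, j)` is `t_j` with
color `i`. They are ordered first by color, then by position in `R(c)`. -/
abbrev ColoredRefl (cs : CoxeterSystem M W) [Finite W] (c : CoxeterWord B) (m : ℕ) : Type :=
  Fin (m + 1) ×ₗ Fin (reflWord cs c).length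

variable {cs : CoxeterSystem M W} [Finite W] {c : CoxeterWord B} {m : ℕ}

/-- The reflection underlying a colored reflection. -/
noncomputable def ColoredRefl.refl (q : ColoredRefl cs c m) : W :=
  (reflWord cs c).get (ofLex q).2

/-- `r'` is the same reflection as `r`, with color one larger. -/
def ColoredRefl.IsNext (r r' : ColoredRefl cs c m) : Prop :=
  ((ofLex r').1 : ℕ) = (ofLex r).1 + 1 ∧ (ofLex r').2 = (ofLex r).2

/-- An `m`-factorization of `c`: a subword of `R(c)^{m+1}`, given by the set of its colored
reflections, that is a reduced word in the reflections for the Coxeter element. -/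
@[ext]
structure MFactorization (cs : CoxeterSystem M W) (c : CoxeterWord B) (m : ℕ) where
  letters : Finset (ColoredRefl cs c m)
  prod_eq : ((letters.sort (· ≤ ·)).map ColoredRefl.refl).prod = cs.wordProd c.letters
  card_eq : letters.card = absLength cs (cs.wordProd c.letters)

/-- `w'` is the increasing rotation of `w` at the colored reflection `r = r^{(i)}` of `w`:
`r^{(i)}` is turned into `r^{(i+1)}`, the letters strictly between `r^{(i)}` and `r^{(i+1)}` are
conjugated by `r` and stay between these two letters of `R(c)^{m+1}`, and all other letters
are kept. -/
def IsRotationAt (w w' : MFactorization cs c m) (r : ColoredRefl cs c m) : Prop :=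
  r ∈ w.letters ∧ ∃ r' : ColoredRefl cs c m, r.IsNext r' ∧
    ∀ q : ColoredRefl cs c m, q ∈ w'.letters ↔
      (q < r ∧ q ∈ w.letters) ∨
      (r < q ∧ q < r' ∧ ∃ p ∈ w.letters, r < p ∧ p < r' ∧ q.refl = r.refl * p.refl * r.refl) ∨
      q = r' ∨
      (r' < q ∧ q ∈ w.letters)

/-- `w'` is an increasing rotation of `w`. -/
def IsRotation (w w' : MFactorization cs c m) : Prop := ∃ r, IsRotationAt w w' r

/-! ### The order generated by increasing rotations -/

theorem isNext_lt {r r' : ColoredRefl cs c m} (h : r.IsNext r') : r < r' :=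
  Prod.Lex.lt_iff.2 (Or.inl (by rw [Fin.lt_def]; have := h.1; omega))

theorem isNext_lt_isNext {r r' s s' : ColoredRefl cs c m} (h : r.IsNext r') (k : s.IsNext s')
    (hrs : r < s) : r' < s' := by
  obtain ⟨h1, h2⟩ := h
  obtain ⟨k1, k2⟩ := k
  rw [Prod.Lex.lt_iff] at hrs ⊢
  rw [h2, k2]
  rcases hrs with hrs | ⟨hrs, h3⟩
  · left; rw [Fin.lt_def] at hrs ⊢; omega
  · right; refine ⟨?_, h3⟩; rw [Fin.ext_iff] at hrs ⊢; omega

theorem isReflection_refl (q : ColoredRefl cs c m) : cs.IsReflection q.refl :=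
  cs.isReflection_of_mem_leftInvSeq _ (List.get_mem _ _)

theorem no_repeat_aux (w : MFactorization cs c m) (a b d : List (ColoredRefl cs c m))
    {x y : ColoredRefl cs c m} (hxy : x.refl = y.refl)
    (h : w.letters.sort (· ≤ ·) = a ++ x :: (b ++ y :: d)) : False := by
  have hp := w.prod_eq
  have hc := w.card_eq
  rw [← Finset.length_sort (· ≤ ·)] at hc
  rw [h] at hp hc
  have hinv : y.refl⁻¹ = y.refl := (isReflection_refl y).inv
  have key := absLength_le (cs := cs) (w := cs.wordProd c.letters)
    (l := a.map ColoredRefl.refl ++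
      ((b.map ColoredRefl.refl).map (MulAut.conj y.refl) ++ d.map ColoredRefl.refl)) (by
      intro t ht
      simp only [List.mem_append, List.mem_map] at ht
      rcases ht with ⟨q, -, rfl⟩ | ⟨_, ⟨q, -, rfl⟩, rfl⟩ | ⟨q, -, rfl⟩
      · exact isReflection_refl q
      · exact (isReflection_refl q).conj _
      · exact isReflection_refl q) (by
      rw [← hp, List.prod_append, List.prod_append, ← map_list_prod]
      simp only [List.map_append, List.map_cons, List.prod_append, List.prod_cons,
        MulAut.conj_apply, hinv, hxy, mul_assoc])
  simp at key hc
  omega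

/-- A reduced word contains no reflection twice. -/
theorem eq_of_refl_eq (w : MFactorization cs c m) {x y : ColoredRefl cs c m}
    (hx : x ∈ w.letters) (hy : y ∈ w.letters) (hxy : x.refl = y.refl) : x = y := by
  by_contra hne
  rw [← Finset.mem_sort (· ≤ ·)] at hx hy
  obtain ⟨a, b, hab⟩ := List.append_of_mem hx
  rw [hab] at hy
  simp only [List.mem_append, List.mem_cons] at hy
  rcases hy with hy | hy | hy
  · obtain ⟨a', b', hab'⟩ := List.append_of_mem hy
    rw [hab'] at hab
    exact no_repeat_aux w a' b' b hxy.symm (by simpa using hab)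
  · exact hne hy.symm
  · obtain ⟨a', b', hab'⟩ := List.append_of_mem hy
    rw [hab'] at hab
    exact no_repeat_aux w a a' b' hxy hab

/-- `x` is the smallest letter on which `a` and `b` differ, and it belongs to `a`. -/
def FirstDiff (a b : MFactorization cs c m) (x : ColoredRefl cs c m) : Prop :=
  (∀ q < x, q ∈ a.letters ↔ q ∈ b.letters) ∧ x ∈ a.letters ∧ x ∉ b.letters

/-- `x` is the largest letter on which `a` and `b` differ, and it belongs to `b`. -/
def LastDiff (a b : MFactorization cs c m) (x : ColoredRefl cs c m) : Prop :=
  (∀ q, x < q → (q ∈ a.letters ↔ q ∈ b.letters)) ∧ x ∉ a.letters ∧ x ∈ b.letters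

theorem IsRotationAt.firstDiff {a b : MFactorization cs c m} {r : ColoredRefl cs c m}
    (h : IsRotationAt a b r) : FirstDiff a b r := by
  obtain ⟨hr, r', hn, hq⟩ := h
  have hlt := isNext_lt hn
  refine ⟨fun q h => ?_, hr, fun h => ?_⟩
  · rw [hq q]
    constructor
    · exact fun h' => Or.inl ⟨h, h'⟩
    · rintro (h' | h' | h' | h')
      · exact h'.2
      · exact absurd h'.1 h.asymm
      · exact absurd (h' ▸ h) hlt.asymm
      · exact absurd (h'.1.trans h) hlt.asymm
  · rcases (hq r).1 h with h' | h' | h' | h'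
    · exact lt_irrefl _ h'.1
    · exact lt_irrefl _ h'.1
    · exact hlt.ne h'
    · exact absurd h'.1 hlt.asymm

theorem IsRotationAt.lastDiff {a b : MFactorization cs c m} {r : ColoredRefl cs c m}
    (h : IsRotationAt a b r) : ∃ r', r.IsNext r' ∧ LastDiff a b r' := by
  obtain ⟨hr, r', hn, hq⟩ := h
  have hlt := isNext_lt hn
  refine ⟨r', hn, fun q h => ?_, fun h => ?_, ?_⟩
  · rw [hq q]
    constructor
    · exact fun h' => Or.inr (Or.inr (Or.inr ⟨h, h'⟩))
    · rintro (h' | h' | h' | h')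
      · exact h'.2
      · exact absurd h'.2.1 h.asymm
      · exact absurd h' h.ne'
      · exact h'.2
  · refine hlt.ne (eq_of_refl_eq a hr h ?_)
    unfold ColoredRefl.refl
    rw [hn.2]
  · exact (hq r').2 (Or.inr (Or.inr (Or.inl rfl)))

theorem FirstDiff.trans {a b d : MFactorization cs c m} {x y : ColoredRefl cs c m}
    (h : FirstDiff a b x) (k : FirstDiff b d y) : FirstDiff a d (min x y) := by
  obtain ⟨h1, h2, h3⟩ := h
  obtain ⟨k1, k2, k3⟩ := k
  refine ⟨fun q hq => (h1 q (lt_min_iff.1 hq).1).trans (k1 q (lt_min_iff.1 hq).2), ?_⟩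
  rcases lt_trichotomy x y with hxy | rfl | hxy
  · rw [min_eq_left hxy.le]; exact ⟨h2, fun h => h3 ((k1 x hxy).2 h)⟩
  · exact absurd k2 h3
  · rw [min_eq_right hxy.le]; exact ⟨(h1 y hxy).2 k2, k3⟩

theorem LastDiff.trans {a b d : MFactorization cs c m} {x y : ColoredRefl cs c m}
    (h : LastDiff a b x) (k : LastDiff b d y) : LastDiff a d (max x y) := by
  obtain ⟨h1, h2, h3⟩ := h
  obtain ⟨k1, k2, k3⟩ := k
  refine ⟨fun q hq => (h1 q (max_lt_iff.1 hq).1).trans (k1 q (max_lt_iff.1 hq).2), ?_⟩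
  rcases lt_trichotomy x y with hxy | rfl | hxy
  · rw [max_eq_right hxy.le]; exact ⟨fun h => k2 ((h1 y hxy).1 h), k3⟩
  · exact absurd h3 k2
  · rw [max_eq_left hxy.le]; exact ⟨h2, (k1 x hxy).1 h3⟩

theorem FirstDiff.unique {a b : MFactorization cs c m} {x y : ColoredRefl cs c m}
    (h : FirstDiff a b x) (k : FirstDiff a b y) : x = y := by
  rcases lt_trichotomy x y with hxy | hxy | hxy
  · exact absurd ((k.1 x hxy).1 h.2.1) h.2.2
  · exact hxy
  · exact absurd ((h.1 y hxy).1 k.2.1) k.2.2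

theorem LastDiff.unique {a b : MFactorization cs c m} {x y : ColoredRefl cs c m}
    (h : LastDiff a b x) (k : LastDiff a b y) : x = y := by
  rcases lt_trichotomy x y with hxy | hxy | hxy
  · exact absurd ((h.1 y hxy).2 k.2.2) k.2.1
  · exact hxy
  · exact absurd ((k.1 x hxy).2 h.2.2) h.2.1

theorem exists_diff {a b : MFactorization cs c m} (h : Relation.ReflTransGen IsRotation a b) :
    a = b ∨ ((∃ x, FirstDiff a b x) ∧ ∃ y, LastDiff a b y) := by
  induction h with
  | refl => exact Or.inl rfl
  | tail _ hs ih =>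
    obtain ⟨r, hr⟩ := hs
    obtain ⟨r', -, hl⟩ := hr.lastDiff
    right
    rcases ih with rfl | ⟨⟨x, hx⟩, y, hy⟩
    · exact ⟨⟨r, hr.firstDiff⟩, r', hl⟩
    · exact ⟨⟨_, hx.trans hr.firstDiff⟩, _, hy.trans hl⟩

/-- The order of the `m`-Cambrian lattice (noncrossing version): the reflexive and transitive
closure of increasing rotations. -/
instance instPartialOrder : PartialOrder (MFactorization cs c m) where
  le := Relation.ReflTransGen IsRotation
  le_refl _ := Relation.ReflTransGen.refl
  le_trans _ _ _ := Relation.ReflTransGen.trans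
  le_antisymm a b h k := by
    rcases exists_diff h with h | ⟨⟨x, hx⟩, -⟩
    · exact h
    rcases exists_diff k with k | ⟨⟨y, hy⟩, -⟩
    · exact k.symm
    · have hz := hx.trans hy
      exact absurd hz.2.1 hz.2.2

/-- The covering relations of the `m`-Cambrian lattice are exactly the increasing rotations. -/
theorem covBy_iff_isRotation {a b : MFactorization cs c m} : a ⋖ b ↔ IsRotation a b := by
  constructor
  · intro h
    rcases Relation.ReflTransGen.cases_head (show Relation.ReflTransGen IsRotation a b from h.le)
      with h' | ⟨d, had, hdb⟩
    · exact absurd h' h.lt.ne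
    · have hle : a ≤ d := Relation.ReflTransGen.single had
      have hle' : d ≤ b := hdb
      rcases h.eq_or_eq hle hle' with rfl | rfl
      · obtain ⟨r, hr⟩ := had
        exact absurd hr.firstDiff.2.1 hr.firstDiff.2.2
      · exact had
  · rintro ⟨r, hr⟩
    obtain ⟨r', hn, hl⟩ := hr.lastDiff
    have hle : a ≤ b := Relation.ReflTransGen.single ⟨r, hr⟩
    refine ⟨lt_of_le_of_ne hle ?_, ?_⟩
    · rintro rfl
      exact absurd hr.firstDiff.2.1 hr.firstDiff.2.2
    · intro u hau hub
      rcases Relation.ReflTransGen.cases_head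
        (show Relation.ReflTransGen IsRotation a u from hau.le) with h' | ⟨d, ⟨s, hs⟩, hdu⟩
      · exact hau.ne h'
      · have hdb : d < b := lt_of_le_of_lt (show d ≤ u from hdu) hub
        obtain ⟨s', hsn, hsl⟩ := hs.lastDiff
        rcases exists_diff (show Relation.ReflTransGen IsRotation d b from hdb.le) with
          h' | ⟨⟨x, hx⟩, y, hy⟩
        · exact hdb.ne h'
        · have h1 : r ≤ s := (hr.firstDiff.unique (hs.firstDiff.trans hx)).le.trans
            (min_le_left _ _)
          have h2 : s' ≤ r' := (le_max_left _ _).trans (hl.unique (hsl.trans hy)).ge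
          have h3 : r = s := by
            rcases h1.lt_or_eq with h | h
            · exact absurd (isNext_lt_isNext hn hsn h) h2.not_gt
            · exact h
          subst h3
          refine hdb.ne (MFactorization.ext (Finset.ext fun q => ?_))
          obtain ⟨-, z, hz, hqz⟩ := hr
          obtain ⟨-, z', hz', hqz'⟩ := hs
          have hzz : z = z' := by
            apply ofLex.injective
            refine Prod.ext (Fin.ext ?_) (hz.2.trans hz'.2.symm)
            rw [hz.1, hz'.1]
          subst hzz
          rw [hqz, hqz']

/-- Saturated chains `w₀ ⋖ w₁ ⋖ ⋯ ⋖ w_k` (of any length `k ≥ 0`) of `m`-factorizations. -/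
abbrev SaturatedChain (cs : CoxeterSystem M W) (c : CoxeterWord B) (m : ℕ) : Type :=
  RelSeries {x : MFactorization cs c m × MFactorization cs c m | x.1 ⋖ x.2}

/-- A saturated chain is `c`-increasing when its rotated reflections, read along the chain,
increase in the extended reflection order. -/
def SaturatedChain.IsIncreasing (p : SaturatedChain cs c m) : Prop :=
  ∃ ρ : Fin p.length → ColoredRefl cs c m,
    (∀ i : Fin p.length, IsRotationAt (p i.castSucc) (p i.succ) (ρ i)) ∧ Monotone ρ

end Coxeter

end MCambrian

/-!
An increasing rotation at `r` leaves all letters below `r` in place and removes `r`, so `r` is the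
first letter on which the two `m`-factorizations differ. Composing rotations takes minima of first
differences (`FirstDiff.trans`); along a `c`-increasing chain the minimum is attained at the first
step. Hence the rotated reflection at any step is the first letter on which the current
`m`-factorization differs from the final one (`SaturatedChain.firstDiff_last`). Since
`m`-factorization and rotated reflection determine the rotation (`IsRotationAt.right_unique`), a
`c`-increasing chain is reconstructed step by step from its two ends, and it stops exactly when it
reaches its last element.
-/

namespace MCambrian

variable {B W : Type*} [Group W] [Finite W] {M : CoxeterMatrix B} {cs : CoxeterSystem M W}
  {c : CoxeterWord B} {m : ℕ}

theorem ColoredRefl.IsNext.right_unique {r s t : ColoredRefl cs c m} (hs : r.IsNext s)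
    (ht : r.IsNext t) : s = t :=
  ofLex.injective (Prod.ext (Fin.ext (hs.1.trans ht.1.symm)) (hs.2.trans ht.2.symm))

theorem IsRotationAt.right_unique {a b d : MFactorization cs c m} {r : ColoredRefl cs c m}
    (hb : IsRotationAt a b r) (hd : IsRotationAt a d r) : b = d := by
  obtain ⟨-, z, hz, hqb⟩ := hb
  obtain ⟨-, z', hz', hqd⟩ := hd
  obtain rfl := hz.right_unique hz'
  exact MFactorization.ext (Finset.ext fun q => by rw [hqb, hqd])

theorem FirstDiff.ne {a b : MFactorization cs c m} {x : ColoredRefl cs c m}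
    (h : FirstDiff a b x) : a ≠ b := by
  rintro rfl
  exact h.2.2 h.2.1

/-- In a `c`-increasing chain, the first difference between an element and any later one is the
reflection rotated right after the former, because later rotations only affect letters that are
at least as large. -/
theorem SaturatedChain.firstDiff_of_le {p : SaturatedChain cs c m}
    {ρ : Fin p.length → ColoredRefl cs c m}
    (hρ : ∀ i : Fin p.length, IsRotationAt (p i.castSucc) (p i.succ) (ρ i)) (hmono : Monotone ρ)
    {k n : ℕ} (hkn : k ≤ n) (hn : n < p.length) :
    FirstDiff (p ⟨k, by omega⟩) (p ⟨n + 1, by omega⟩) (ρ ⟨k, by omega⟩) := by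
  induction n, hkn using Nat.le_induction with
  | base => exact (hρ ⟨k, hn⟩).firstDiff
  | succ n hkn ih =>
    have h := (ih (by omega)).trans (hρ ⟨n + 1, hn⟩).firstDiff
    rwa [min_eq_left (hmono (Fin.mk_le_mk.2 (by omega)))] at h

theorem SaturatedChain.firstDiff_last {p : SaturatedChain cs c m}
    {ρ : Fin p.length → ColoredRefl cs c m}
    (hρ : ∀ i : Fin p.length, IsRotationAt (p i.castSucc) (p i.succ) (ρ i)) (hmono : Monotone ρ)
    {k : ℕ} (hk : k < p.length) :
    FirstDiff (p ⟨k, by omega⟩) p.last (ρ ⟨k, hk⟩) := by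
  have h := firstDiff_of_le hρ hmono (k := k) (n := p.length - 1) (by omega) (by omega)
  have hlast : (⟨p.length - 1 + 1, by omega⟩ : Fin (p.length + 1)) = Fin.last p.length :=
    Fin.ext (by simp only [Fin.val_last]; omega)
  rwa [hlast] at h

/-- Two `c`-increasing chains with the same ends agree as long as both are defined. -/
theorem SaturatedChain.IsIncreasing.apply_eq {p q : SaturatedChain cs c m} (hp : p.IsIncreasing)
    (hq : q.IsIncreasing) (hhead : p.head = q.head) (hlast : p.last = q.last) (k : ℕ)
    (hkp : k < p.length + 1) (hkq : k < q.length + 1) : p ⟨k, hkp⟩ = q ⟨k, hkq⟩ := by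
  obtain ⟨ρ, hρ, hρm⟩ := hp
  obtain ⟨σ, hσ, hσm⟩ := hq
  induction k with
  | zero => exact hhead
  | succ k ih =>
    have heq := ih (by omega) (by omega)
    have h1 := firstDiff_last hρ hρm (k := k) (by omega)
    have h2 := firstDiff_last hσ hσm (k := k) (by omega)
    rw [heq, hlast] at h1
    have hr := h1.unique h2
    have hp' : IsRotationAt (p ⟨k, by omega⟩) (p ⟨k + 1, hkp⟩) (ρ ⟨k, by omega⟩) :=
      hρ ⟨k, by omega⟩
    have hq' : IsRotationAt (q ⟨k, by omega⟩) (q ⟨k + 1, hkq⟩) (σ ⟨k, by omega⟩) :=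
      hσ ⟨k, by omega⟩
    rw [heq, hr] at hp'
    exact hp'.right_unique hq'

/-- A `c`-increasing chain cannot continue past its last element, since every earlier element has
a first difference from it. -/
theorem SaturatedChain.IsIncreasing.length_le {p q : SaturatedChain cs c m} (hp : p.IsIncreasing)
    (hq : q.IsIncreasing) (hhead : p.head = q.head) (hlast : p.last = q.last) :
    q.length ≤ p.length := by
  by_contra! hlt
  have heq := hp.apply_eq hq hhead hlast p.length (by omega) (by omega)
  obtain ⟨σ, hσ, hσm⟩ := hq
  exact (firstDiff_last hσ hσm hlt).ne (heq.symm.trans hlast)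

end MCambrian

/-- Between two `m`-factorizations there is at most one `c`-increasing saturated chain. -/
theorem mainTheorem4 {B W : Type*} [Group W] [Finite W] {M : CoxeterMatrix B}
    (cs : CoxeterSystem M W) (c : MCambrian.CoxeterWord B) (m : ℕ)
    (w w' : MCambrian.MFactorization cs c m) (p q : MCambrian.SaturatedChain cs c m)
    (hp : p.IsIncreasing) (hpw : p.head = w) (hpw' : p.last = w')
    (hq : q.IsIncreasing) (hqw : q.head = w) (hqw' : q.last = w') :
    p = q := by
  have hhead : p.head = q.head := hpw.trans hqw.symm
  have hlast : p.last = q.last := hpw'.trans hqw'.symm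
  have hlen : p.length = q.length :=
    le_antisymm (hq.length_le hp hhead.symm hlast.symm) (hp.length_le hq hhead hlast)
  exact RelSeries.ext hlen (funext fun i => hp.apply_eq hq hhead hlast i i.2 (by omega))
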